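/- **Theorem 4.1.** For $g\in SL(2,\mathbb R)$ let $Q_g(v)=L_g^+(v)L_g^-(v)$, where $(L_g^-(v),L_g^+(v))=g^{-1}v$ for $v\in\mathbb R^2$; thus $Q_g(v)=Q_0(g^{-1}v)$ with $Q_0(x,y)=xy$. Let $SL(2,\mathbb R)$ act on $\mathbb R\cup\{\infty\}$ by Möbius transformations, and put $\lambda=\frac12(3-\sqrt5)$. The element $g$ is called $H$-reduced if the numbers $u=g(0)$ and $w=g(\infty)$ (the repelling and attracting endpoints of the geodesic $t\mapsto g\,\mathrm{diag}(e^{t/2},e^{-t/2})(i)$ of the upper half-plane) are real and satisfy $|w|>2$ and $\operatorname{sgn}(w)\,u\in[\lambda-1,\lambda]$. Let $g$ be $H$-reduced with $w=g(\infty)$ irrational, and let $w=[a_0,a_1,\dots]=a_0-\cfrac1{a_1-\cfrac1{a_2-\cdots}}$ be its minus continued fraction expansion with respect to the nearest integer (Hurwitz) algorithm: $w_0=w$, $a_j$ is the integer nearest to $w_j$, and $w_{j+1}=-1/(w_j-a_j)$. (Then $|a_j|\ge2$ for all $j$.) Let $0<\delta<\sqrt{2/\pi}$ and $\kappa>0$,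 and for $\rho>0$ let $$G(\rho)=\{p\in\mathbb Z^2 \text{ primitive}: 0<|Q_g(p)|<\tfrac12\delta^2,\ L_g^-(p)>\kappa,\ \|p\|\le\rho\},$$ where $\|\cdot\|$ is the Euclidean norm. For $n\in\mathbb N=\{0,1,2,\dots\}$ put $$\alpha_n=\sum_{j=0}^{n-1}\log|a_j|,\qquad \omega_n=\sum_{j=0}^{n-1}\chi_j,\qquad c_0=\tfrac12\log(3\sqrt5)+\tfrac12\log\Bigl(\tfrac34+\sqrt{\tfrac12}\Bigr),$$ $$e(\delta,n)=\#\{0\le j\le n-1: |a_j|>2\delta^{-2}+\tfrac12+\lambda\},\qquad f(\delta,n)=\#\{0\le j\le n-1: |a_j|>2\delta^{-2}-\tfrac32+\lambda\},$$ where $\chi_j=\frac12\log(3\sqrt5)$ if $|a_j|\ge3$, and $\chi_j=\log2-\frac12d\bigl(\mu+i\sqrt{1-\mu^2},\frac12(3+i\sqrt3)\bigr)$ if $|a_j|=2$, with $\mu=\frac1{22}(23-3\sqrt5)$ and $d$ the hyperbolic distance of the upper half-plane. Then there are constants $\theta\ge0$ and $\nu\in\mathbb N$ (depending only on $g$, $\delta$,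 $\kappa$) such that for all $n\in\mathbb N$ and all $\rho>0$: (i) if $\log\rho\ge\alpha_n+c_0n+\theta$, then $\#G(\rho)\ge e(\delta,n)-\nu$; (ii) if $\log\rho\le\alpha_n-\omega_n-\theta$, then $\#G(\rho)\le f(\delta,n)+\nu$. -/

import Mathlib

open scoped MatrixGroups

noncomputable section

namespace HReducedForms

/-! ### The quadratic form attached to `g ∈ SL(2, ℝ)` -/

/-- The real vector with integral coordinates `p = (x, y)`. -/
def realVec (p : ℤ × ℤ) : Fin 2 → ℝ := ![(p.1 : ℝ), (p.2 : ℝ)]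

/-- The set of primitive integral pairs. -/
def primitivePairs : Set (ℤ × ℤ) := {p | Int.gcd p.1 p.2 = 1}

/-- The Euclidean norm of an integral pair. -/
def euclNorm (p : ℤ × ℤ) : ℝ := ‖!₂[(p.1 : ℝ), (p.2 : ℝ)]‖

/-- The quadratic form `Q₀(x, y) = x y`. -/
def Q₀ (v : Fin 2 → ℝ) : ℝ := v 0 * v 1

/-- The quadratic form `Q_g(v) = Q₀(g⁻¹ v)`. -/
def Q (g : SL(2, ℝ)) (v : Fin 2 → ℝ) : ℝ :=
  Q₀ ((g⁻¹ : SL(2, ℝ)).val.mulVec v)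

/-- The linear form `L_g^-`: the first coordinate of `g⁻¹ v`. Under the flow
`g_t = g * diag (e ^ (t / 2), e ^ (-t / 2)) * g⁻¹`, which preserves `Q_g`, one has
`L_g^- (g_t v) = e ^ (t / 2) * L_g^- v`, so the orbits are asymptotic to `L_g^- = 0` as
`t → -∞`. -/
def Lminus (g : SL(2, ℝ)) (v : Fin 2 → ℝ) : ℝ := (g⁻¹ : SL(2, ℝ)).val.mulVec v 0

/-- The linear form `L_g^+`: the second coordinate of `g⁻¹ v`. -/
def Lplus (g : SL(2, ℝ)) (v : Fin 2 → ℝ) : ℝ := (g⁻¹ : SL(2, ℝ)).val.mulVec v 1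

theorem Q_eq_Lplus_mul_Lminus (g : SL(2, ℝ)) (v : Fin 2 → ℝ) :
    Q g v = Lplus g v * Lminus g v :=
  mul_comm _ _

/-- The set `G(ρ)` of primitive solutions `p` of `0 < |Q_g(p)| < δ² / 2`, `L_g^-(p) > κ`,
`‖p‖ ≤ ρ`. -/
def solutions (g : SL(2, ℝ)) (δ κ ρ : ℝ) : Set (ℤ × ℤ) :=
  {p | p ∈ primitivePairs ∧ 0 < |Q g (realVec p)| ∧ |Q g (realVec p)| < 1 / 2 * δ ^ 2 ∧
    κ < Lminus g (realVec p) ∧ euclNorm p ≤ ρ}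

/-- `G(ρ)` is finite, so that its `Set.ncard` is its cardinality. -/
theorem solutions_finite (g : SL(2, ℝ)) (δ κ ρ : ℝ) : (solutions g δ κ ρ).Finite := by
  refine ((Set.finite_Icc (-⌈ρ⌉) ⌈ρ⌉).prod (Set.finite_Icc (-⌈ρ⌉) ⌈ρ⌉)).subset ?_
  rintro ⟨x, y⟩ ⟨-, -, -, -, h⟩
  have h0 := PiLp.norm_apply_le (!₂[(x : ℝ), (y : ℝ)]) 0
  have h1 := PiLp.norm_apply_le (!₂[(x : ℝ), (y : ℝ)]) 1
  simp only [euclNorm] at h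
  have hx : |(x : ℝ)| ≤ ⌈ρ⌉ := by
    simpa using (h0.trans h).trans (Int.le_ceil ρ)
  have hy : |(y : ℝ)| ≤ ⌈ρ⌉ := by
    simpa using (h1.trans h).trans (Int.le_ceil ρ)
  rw [abs_le] at hx hy
  simp only [Set.mem_prod, Set.mem_Icc]
  exact ⟨⟨by exact_mod_cast hx.1, by exact_mod_cast hx.2⟩,
    ⟨by exact_mod_cast hy.1, by exact_mod_cast hy.2⟩⟩

/-! ### `H`-reduced elements -/

/-- `λ = (3 - √5) / 2`. -/
def lam : ℝ := (3 - √5) / 2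

/-- `g(ξ)` for `ξ` in the boundary `ℝ ∪ {∞}` of the upper half-plane (Möbius action). -/
def bdryAct (g : SL(2, ℝ)) (ξ : OnePoint ℝ) : OnePoint ℝ :=
  Matrix.SpecialLinearGroup.toGL g • ξ

theorem bdryAct_infty (g : SL(2, ℝ)) :
    bdryAct g OnePoint.infty =
      if g.val 1 0 = 0 then OnePoint.infty else ((g.val 0 0 / g.val 1 0 : ℝ) : OnePoint ℝ) :=
  OnePoint.smul_infty_eq_ite _

theorem bdryAct_coe (g : SL(2, ℝ)) (x : ℝ) :
    bdryAct g (x : OnePoint ℝ) =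
      if g.val 1 0 * x + g.val 1 1 = 0 then OnePoint.infty
      else (((g.val 0 0 * x + g.val 0 1) / (g.val 1 0 * x + g.val 1 1) : ℝ) : OnePoint ℝ) :=
  OnePoint.smul_some_eq_ite

/-- `g` is `H`-reduced: the geodesic `t ↦ g * diag (e ^ (t / 2), e ^ (-t / 2)) (i)`, which has
repelling endpoint `u = g(0)` and attracting endpoint `w = g(∞)`, satisfies `|w| > 2` and
`sgn(w) u ∈ [λ - 1, λ]`. Both endpoints are required to be real numbers. -/
def IsHReduced (g : SL(2, ℝ)) : Prop :=
  ∃ u w : ℝ, bdryAct g ((0 : ℝ) : OnePoint ℝ) = (u : OnePoint ℝ) ∧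
    bdryAct g OnePoint.infty = (w : OnePoint ℝ) ∧
    2 < |w| ∧ Real.sign w * u ∈ Set.Icc (lam - 1) lam

/-! ### The Hurwitz (nearest integer) algorithm for minus continued fractions -/

/-- The complete quotients: `w₀ = w`, `w_{j+1} = -1 / (w_j - a_j)`, with `a_j` the integer nearest
to `w_j`. For irrational `w` all the `w_j` are irrational: no division by zero, and the
nearest integer is unique. -/
def completeQuotient (w : ℝ) : ℕ → ℝ
  | 0 => w
  | j + 1 => -1 / (completeQuotient w j - (round (completeQuotient w j) : ℝ))

/-- The partial quotients `a_j` in `w = [a₀, a₁, …] = a₀ - 1 / (a₁ - 1 / (a₂ - ⋯))`. -/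
def digit (w : ℝ) (j : ℕ) : ℤ := round (completeQuotient w j)

/-- `|a_j|` as a real number. -/
def absDigit (w : ℝ) (j : ℕ) : ℝ := |(digit w j : ℝ)|

/-- `α_n = ∑_{j < n} log |a_j|`. -/
def alpha (w : ℝ) (n : ℕ) : ℝ := ∑ j ∈ Finset.range n, Real.log (absDigit w j)

/-- `e(δ, n)`, the number of `j < n` with `|a_j| > 2 δ⁻² + 1/2 + λ`. -/
def eCount (w δ : ℝ) (n : ℕ) : ℕ :=
  ((Finset.range n).filter fun j => 2 / δ ^ 2 + 1 / 2 + lam < absDigit w j).card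

/-- `f(δ, n)`, the number of `j < n` with `|a_j| > 2 δ⁻² - 3/2 + λ`. -/
def fCount (w δ : ℝ) (n : ℕ) : ℕ :=
  ((Finset.range n).filter fun j => 2 / δ ^ 2 - 3 / 2 + lam < absDigit w j).card

/-! ### The constants -/

/-- `c₀ = (1/2) log (3 √5) + (1/2) log (3/4 + √(1/2))`. -/
def c₀ : ℝ := 1 / 2 * Real.log (3 * √5) + 1 / 2 * Real.log (3 / 4 + √(1 / 2))

/-- `μ = (23 - 3 √5) / 22`. -/
def mu : ℝ := (23 - 3 * √5) / 22

theorem mu_sq_lt_one : mu ^ 2 < 1 := by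
  have h1 : (√5) ^ 2 = 5 := Real.sq_sqrt (by norm_num)
  have h2 : 0 ≤ √5 := Real.sqrt_nonneg 5
  have h3 : √5 < 3 := by nlinarith
  have h4 : 2 < √5 := by nlinarith
  unfold mu
  nlinarith

/-- The point `μ + i √(1 - μ²)` of the upper half-plane. -/
def cornerPoint : UpperHalfPlane :=
  ⟨⟨mu, √(1 - mu ^ 2)⟩, Real.sqrt_pos.mpr (sub_pos.mpr mu_sq_lt_one)⟩

/-- The point `(3 + i √3) / 2` of the upper half-plane. -/
def vertexPoint : UpperHalfPlane :=
  ⟨⟨3 / 2, √3 / 2⟩, half_pos (Real.sqrt_pos.mpr (by norm_num))⟩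

/-- `χ_j = log 2 - (1/2) d(μ + i √(1 - μ²), (3 + i √3) / 2)` if `|a_j| = 2`, where `d` is the
hyperbolic distance, and `χ_j = (1/2) log (3 √5)` otherwise, i.e. if `|a_j| ≥ 3`. -/
def chi (w : ℝ) (j : ℕ) : ℝ :=
  if |digit w j| = 2 then Real.log 2 - 1 / 2 * dist cornerPoint vertexPoint
  else 1 / 2 * Real.log (3 * √5)

/-- `ω_n = ∑_{j < n} χ_j`. -/
def omega (w : ℝ) (n : ℕ) : ℝ := ∑ j ∈ Finset.range n, chi w j

end HReducedForms

end

noncomputable section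

namespace HReducedForms

/-! Up to constant factors, `L_g^-` and `L_g^+` are the forms `x - u y` and `x - w y`, and `|Q_g|`
is the absolute value of their product divided by `|w - u|`. The maps `ξ ↦ 1 / (a_j - ξ)` carry `(u,
w)` through reduced pairs `(u_j, w_j)`. In the unimodular basis of two successive convergents the
form looks the same with `(u_j, w_j)` in place of `(u, w)`, so `|Q_g| = 1 / |w_j - u_j|` at the
`j`-th convergent. Since `|w_j - u_j|` lies between `|a_j| - 1/2 - λ` and `|a_j| + 3/2 - λ`, large
digits give solutions and solutions among convergents need large digits; this is where the
thresholds in `e` and `f` come from.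

Conversely `δ² < 2/π` forces `|Q_g| < 1/3`, and a Legendre type criterion (`eq_conv_of_small`) shows
that a solution with `|x - u y| ≥ 1` is a convergent up to sign. The norm is comparable to `|x - u
y|` at convergents, where this form equals `∏ (a_j - u_j)`; `abs_lin_u_le_prod` and
`prod_le_abs_lin_u` compare that product with `exp (α_n + c₀ n)` and `exp (α_n - ω_n)`. The
exceptions, early convergents with `L_g^- ≤ κ` and solutions with `|x - u y| < 1`, are bounded in
number and go into `ν`. -/

theorem lam_sq : lam ^ 2 = 3 * lam - 1 := by
  have h : (√5) ^ 2 = 5 := Real.sq_sqrt (by norm_num)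
  unfold lam
  linear_combination h / 4

theorem lam_bounds : 0.38 < lam ∧ lam < 0.382 := by
  have h : (√5) ^ 2 = 5 := Real.sq_sqrt (by norm_num)
  have h2 : 0 ≤ √5 := Real.sqrt_nonneg 5
  unfold lam
  constructor <;> nlinarith

/-! ### Reduced pairs of endpoints -/

/-- The pair `(u, w)` is reduced with `w` positive. -/
def PosReduced (u w : ℝ) : Prop := 2 < w ∧ lam - 1 ≤ u ∧ u ≤ lam

/-- The pair `(u, w)` is reduced: `|w| > 2` and `sgn(w) u ∈ [λ - 1, λ]`. -/
def Reduced (u w : ℝ) : Prop := PosReduced u w ∨ PosReduced (-u) (-w)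

theorem Reduced.neg {u w : ℝ} (h : Reduced u w) : Reduced (-u) (-w) := by
  rcases h with h | h
  · exact Or.inr (by simpa using h)
  · exact Or.inl h

theorem reduced_of_sign {u w : ℝ} (hw : 2 < |w|)
    (hu : Real.sign w * u ∈ Set.Icc (lam - 1) lam) : Reduced u w := by
  rcases lt_abs.mp hw with h | h
  · rw [Real.sign_of_pos (by linarith)] at hu
    exact Or.inl ⟨h, by simpa using hu.1, by simpa using hu.2⟩
  · rw [Real.sign_of_neg (by linarith)] at hu
    exact Or.inr ⟨h, by simpa using hu.1, by simpa using hu.2⟩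

theorem PosReduced.two_le {u w : ℝ} {a : ℤ} (h : PosReduced u w) (ha : |w - a| < 1 / 2) :
    2 ≤ a := by
  have h1 := abs_lt.mp ha
  have : (1 : ℝ) < a := by linarith [h.1, h1.2]
  exact_mod_cast this

/-- The interval `[λ - 1, λ]` fits because `(2 - λ)(1 - λ) = 1` and `(3 - λ) λ = 1`. If `w < a`,
then `a ≥ 3` and the new `u` is at most `λ`; if `w > a`, the new `w` is negative and the bound `1 -
λ` suffices. -/
theorem PosReduced.step {u w : ℝ} {a : ℤ} (h : PosReduced u w) (ha : |w - a| < 1 / 2)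
    (hne : w ≠ a) : Reduced (1 / (a - u)) (1 / (a - w)) := by
  have h2 := h.two_le ha
  obtain ⟨hw, hu1, hu2⟩ := h
  obtain ⟨l1, l2⟩ := lam_bounds
  have hl := lam_sq
  have ha' := abs_lt.mp ha
  have h2' : (2 : ℝ) ≤ a := by exact_mod_cast h2
  have hpos : 0 < a - u := by linarith
  have hup : 1 / (a - u) ≤ 1 - lam := by
    rw [div_le_iff₀ hpos]; nlinarith
  have hu0 : 0 < 1 / (a - u) := by positivity
  rcases lt_or_gt_of_ne hne with hlt | hgt
  · have h3 : (3 : ℝ) ≤ a := by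
      have : (2 : ℝ) < a := by linarith
      have : 2 < a := by exact_mod_cast this
      exact_mod_cast this
    refine Or.inl ⟨?_, by linarith, ?_⟩
    · rw [lt_div_iff₀ (by linarith)]; linarith
    · rw [div_le_iff₀ hpos]; nlinarith
  · refine Or.inr ⟨?_, by linarith, by linarith⟩
    rw [← div_neg, lt_div_iff₀ (by linarith)]; linarith

theorem Reduced.step {u w : ℝ} {a : ℤ} (h : Reduced u w) (ha : |w - a| < 1 / 2)
    (hne : w ≠ a) : Reduced (1 / (a - u)) (1 / (a - w)) := by
  rcases h with h | h
  · exact h.step ha hne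
  · have key := (h.step (a := -a)
      (by rw [← abs_neg]; push_cast; convert ha using 2; ring)
      (by push_cast; simpa using hne)).neg
    convert key using 1
    · rw [← div_neg]; push_cast; congr 1; ring
    · rw [← div_neg]; push_cast; congr 1; ring

theorem Reduced.exists_sign {u w : ℝ} {a : ℤ} (h : Reduced u w) (ha : |w - a| < 1 / 2) :
    ∃ (u' w' : ℝ) (a' : ℤ), PosReduced u' w' ∧ |w' - a'| < 1 / 2 ∧
      (u' = u ∧ w' = w ∧ a' = a ∨ u' = -u ∧ w' = -w ∧ a' = -a) := by
  rcases h with h | h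
  · exact ⟨u, w, a, h, ha, Or.inl ⟨rfl, rfl, rfl⟩⟩
  · refine ⟨-u, -w, -a, h, ?_, Or.inr ⟨rfl, rfl, rfl⟩⟩
    rw [← abs_neg]; push_cast; convert ha using 2; ring

theorem PosReduced.bounds {u w : ℝ} {a : ℤ} (h : PosReduced u w) (ha : |w - a| < 1 / 2) :
    2 ≤ |(a : ℝ)| ∧ |(a : ℝ)| - lam ≤ |a - u| ∧ |a - u| ≤ |(a : ℝ)| + 1 - lam ∧
    |(a : ℝ)| - 1 / 2 - lam ≤ |w - u| ∧ |w - u| ≤ |(a : ℝ)| + 3 / 2 - lam ∧ 1.6 < |w - u| := by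
  have h2 : (2 : ℝ) ≤ a := by exact_mod_cast h.two_le ha
  obtain ⟨hw, hu1, hu2⟩ := h
  obtain ⟨l1, l2⟩ := lam_bounds
  have ha' := abs_lt.mp ha
  rw [abs_of_pos (by linarith : (0 : ℝ) < a), abs_of_pos (by linarith : 0 < a - u),
    abs_of_pos (by linarith : 0 < w - u)]
  refine ⟨h2, ?_, ?_, ?_, ?_, ?_⟩ <;> linarith

theorem Reduced.bounds {u w : ℝ} {a : ℤ} (h : Reduced u w) (ha : |w - a| < 1 / 2) :
    2 ≤ |(a : ℝ)| ∧ |(a : ℝ)| - lam ≤ |a - u| ∧ |a - u| ≤ |(a : ℝ)| + 1 - lam ∧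
    |(a : ℝ)| - 1 / 2 - lam ≤ |w - u| ∧ |w - u| ≤ |(a : ℝ)| + 3 / 2 - lam ∧ 1.6 < |w - u| := by
  obtain ⟨u', w', a', h', ha', ⟨rfl, rfl, rfl⟩ | ⟨rfl, rfl, rfl⟩⟩ := h.exists_sign ha
  · exact h'.bounds ha'
  · have key := h'.bounds ha'
    have e1 : |((-a : ℤ) : ℝ)| = |(a : ℝ)| := by push_cast; exact abs_neg _
    have e2 : |((-a : ℤ) : ℝ) - -u| = |(a : ℝ) - u| := by
      rw [← abs_neg]; push_cast; congr 1; ring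
    have e3 : |-w - -u| = |w - u| := by
      rw [← abs_neg]; congr 1; ring
    rwa [e1, e2, e3] at key

theorem Reduced.abs_le_of_mul_nonpos {u w : ℝ} {a : ℤ} (h : Reduced u w) (ha : |w - a| < 1 / 2)
    (hs : w * u ≤ 0) : |(a : ℝ)| ≤ |a - u| := by
  have ha' := abs_lt.mp ha
  rcases h with h | h
  · have hu : u ≤ 0 := by nlinarith [h.1]
    rw [abs_of_pos (by linarith [h.1]), abs_of_pos (by linarith [h.1])]
    linarith
  · have hu : 0 ≤ u := by nlinarith [h.1]
    rw [abs_of_neg (by linarith [h.1]), abs_of_neg (by linarith [h.1])]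
    linarith

/-- Since `|w| > 2 = |a|`, the difference `a - w` has the sign opposite to `a`, while `a - u` has
the sign of `a`. -/
theorem Reduced.mul_nonpos_of_abs_eq_two {u w : ℝ} {a : ℤ} (h : Reduced u w)
    (ha : |w - a| < 1 / 2) (h2 : |a| = 2) : 1 / (a - w) * (1 / (a - u)) ≤ 0 := by
  obtain ⟨l1, l2⟩ := lam_bounds
  have ha' := abs_lt.mp ha
  rw [div_mul_div_comm, one_mul]
  apply div_nonpos_of_nonneg_of_nonpos zero_le_one
  rcases h with ⟨hw, hu1, hu2⟩ | ⟨hw, hu1, hu2⟩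
  · have : a = 2 := by
      rcases (abs_eq (by norm_num)).mp h2 with h | h
      · exact h
      · rw [h] at ha'; push_cast at ha'; linarith
    subst this
    push_cast
    nlinarith
  · have : a = -2 := by
      rcases (abs_eq (by norm_num)).mp h2 with h | h
      · rw [h] at ha'; push_cast at ha'; linarith
      · exact h
    subst this
    push_cast
    nlinarith

/-! ### A Legendre type criterion -/

/-- With `D = w - u` and `s = x - u y`, the product is `|s| |s - D y|`. For `y ≥ 1` it is at least
`D / 3`, by concavity in `s` on the range that the bounds on `s` leave. -/
theorem PosReduced.eq_zero_of_small {u w : ℝ} {a x y : ℤ} (h : PosReduced u w)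
    (ha : |w - a| < 1 / 2) (h1 : 1 ≤ |x - u * y|) (h2 : |x - u * y| < |a - u|)
    (h3 : 3 * (|x - w * y| * |x - u * y|) < |w - u|) : y = 0 := by
  wlog hy : 0 ≤ y generalizing x y
  · have := @this (-x) (-y) (by rw [← abs_neg]; push_cast; convert h1 using 2; ring)
      (by rw [← abs_neg]; push_cast; convert h2 using 2; ring)
      (by rw [← abs_neg, ← abs_neg (((-x : ℤ) : ℝ) - u * _)]; push_cast
          convert h3 using 4 <;> ring) (by lia)
    lia
  obtain ⟨hw, hu1, hu2⟩ := h
  obtain ⟨l1, l2⟩ := lam_bounds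
  have ha' := abs_lt.mp ha
  rw [abs_of_pos (by linarith : 0 < w - u)] at h3
  rw [abs_of_pos (by linarith : 0 < a - u)] at h2
  by_contra hne
  have hy1 : (1 : ℝ) ≤ y := by exact_mod_cast (by lia : 1 ≤ y)
  have hD : 1.6 < w - u := by linarith
  have hDy : w - u ≤ (w - u) * y := by nlinarith
  have hrel : (x : ℝ) - w * y = (x - u * y) - (w - u) * y := by ring
  rcases lt_or_ge ((x : ℝ) - u * y) 0 with hs | hs
  · rw [abs_of_neg hs] at h1 h3
    rw [abs_of_neg (by linarith)] at h3
    nlinarith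
  · rw [abs_of_nonneg hs] at h1 h2 h3
    rcases eq_or_lt_of_le (by lia : 1 ≤ y) with rfl | hy2
    -- Integrality gives `x ≤ a - 1`, so `1 ≤ s ≤ D - 1/2`; at both ends `3 s (D - s) ≥ D`, because
    -- `D ≥ 3/2`.
    · push_cast at *
      have hx : (x : ℝ) ≤ a - 1 := by
        have : (x : ℝ) < a := by linarith
        have : x < a := by exact_mod_cast this
        exact_mod_cast (by lia : x ≤ a - 1)
      rw [abs_of_neg (by linarith)] at h3
      nlinarith [mul_nonneg (by linarith : 0 ≤ (x : ℝ) - u * 1 - 1)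
        (by linarith : 0 ≤ w - u - 1 / 2 - ((x : ℝ) - u * 1))]
    -- Here only `s ≤ D + 1/2` is available, but `|s - D y| ≥ 2 D - s` compensates.
    · have hy2' : (2 : ℝ) ≤ y := by exact_mod_cast hy2
      have hDy2 : 2 * (w - u) ≤ (w - u) * y := by nlinarith
      rw [abs_of_neg (by linarith)] at h3
      have h4 : (2 * (w - u) - (x - u * y)) * (x - u * y) ≤ -(x - w * y) * (x - u * y) :=
        mul_le_mul_of_nonneg_right (by linarith) hs
      nlinarith [mul_nonneg (by linarith : 0 ≤ (x : ℝ) - u * y - 1)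
        (by linarith : 0 ≤ w - u + 1 / 2 - ((x : ℝ) - u * y))]

theorem Reduced.eq_zero_of_small {u w : ℝ} {a x y : ℤ} (h : Reduced u w)
    (ha : |w - a| < 1 / 2) (h1 : 1 ≤ |x - u * y|) (h2 : |x - u * y| < |a - u|)
    (h3 : 3 * (|x - w * y| * |x - u * y|) < |w - u|) : y = 0 := by
  obtain ⟨u', w', a', h', ha', ⟨rfl, rfl, rfl⟩ | ⟨rfl, rfl, rfl⟩⟩ := h.exists_sign ha
  · exact h'.eq_zero_of_small ha' h1 h2 h3
  · have e2 : |((-a : ℤ) : ℝ) - -u| = |(a : ℝ) - u| := by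
      rw [← abs_neg]; push_cast; congr 1; ring
    have e3 : |-w - -u| = |w - u| := by
      rw [← abs_neg]; congr 1; ring
    have := h'.eq_zero_of_small (x := x) (y := -y) ha' (by push_cast; simpa using h1)
      (by rw [e2]; push_cast; simpa using h2) (by rw [e3]; push_cast; simpa using h3)
    lia

/-! ### Convergents of a minus continued fraction -/

/-- The linear form `x - ξ y`. -/
def lin (ξ : ℝ) (p : ℤ × ℤ) : ℝ := p.1 - ξ * p.2

/-- The images of `ξ` under the successive maps `ξ ↦ 1 / (a_j - ξ)`. -/
def orbit (a : ℕ → ℤ) (ξ : ℝ) : ℕ → ℝ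
  | 0 => ξ
  | j + 1 => 1 / (a j - orbit a ξ j)

/-- Two successive convergents of `[a₀, a₁, …]`, the later one first. -/
def convPair (a : ℕ → ℤ) : ℕ → (ℤ × ℤ) × (ℤ × ℤ)
  | 0 => ((1, 0), (0, -1))
  | j + 1 => (a j • (convPair a j).1 - (convPair a j).2, (convPair a j).1)

/-- The convergents of `[a₀, a₁, …]`, starting with `1 / 0`. -/
def conv (a : ℕ → ℤ) (n : ℕ) : ℤ × ℤ := (convPair a n).1

/-- The predecessors of the convergents of `[a₀, a₁, …]`. -/
def prevConv (a : ℕ → ℤ) (n : ℕ) : ℤ × ℤ := (convPair a n).2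

theorem conv_det (a : ℕ → ℤ) (n : ℕ) :
    (conv a n).2 * (prevConv a n).1 - (conv a n).1 * (prevConv a n).2 = 1 := by
  induction n with
  | zero => simp [conv, prevConv, convPair]
  | succ n ih =>
    simp only [conv, prevConv, convPair, Prod.fst_sub, Prod.snd_sub, Prod.smul_fst, Prod.smul_snd,
      smul_eq_mul] at ih ⊢
    linear_combination ih

theorem conv_mem_primitivePairs (a : ℕ → ℤ) (n : ℕ) : conv a n ∈ primitivePairs := by
  have : IsCoprime (conv a n).1 (conv a n).2 :=
    ⟨-(prevConv a n).2, (prevConv a n).1, by linear_combination conv_det a n⟩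
  exact Int.isCoprime_iff_gcd_eq_one.mp this

/-- The recursion acts on the ratio of the two values of the form by `ξ ↦ 1 / (a_n - ξ)`. The start
`(1, 0)`, `(0, -1)` makes the initial ratio equal to `ξ`. -/
theorem lin_conv_aux (a : ℕ → ℤ) (ξ : ℝ) (hne : ∀ n, (a n : ℝ) - orbit a ξ n ≠ 0) (n : ℕ) :
    lin ξ (prevConv a n) = orbit a ξ n * lin ξ (conv a n) ∧
    lin ξ (conv a n) = ∏ j ∈ Finset.range n, (a j - orbit a ξ j) := by
  induction n with
  | zero => simp [lin, conv, prevConv, convPair, orbit]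
  | succ n ih =>
    have h : lin ξ (conv a (n + 1)) = (a n - orbit a ξ n) * lin ξ (conv a n) := by
      have e : lin ξ (conv a (n + 1)) = a n * lin ξ (conv a n) - lin ξ (prevConv a n) := by
        simp only [lin, conv, prevConv, convPair, Prod.fst_sub, Prod.snd_sub, Prod.smul_fst,
          Prod.smul_snd, smul_eq_mul]
        push_cast
        ring
      rw [e, ih.1]; ring
    refine ⟨?_, ?_⟩
    · rw [h]
      have : prevConv a (n + 1) = conv a n := rfl
      rw [this, orbit, ← mul_assoc, one_div_mul_cancel (hne n), one_mul]
    · rw [Finset.prod_range_succ, ← ih.2, h, mul_comm]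

/-- The basis is unimodular. The minus sign turns `lin ξ p` into `(x - ξ_n y)` times its value at
the convergent. -/
theorem exists_coords (a : ℕ → ℤ) (n : ℕ) (p : ℤ × ℤ) :
    ∃ x y : ℤ, p = x • conv a n - y • prevConv a n := by
  have h := conv_det a n
  refine ⟨p.2 * (prevConv a n).1 - p.1 * (prevConv a n).2,
    (conv a n).1 * p.2 - (conv a n).2 * p.1, ?_⟩
  ext
  · simp only [Prod.fst_sub, Prod.smul_fst, smul_eq_mul]
    linear_combination -p.1 * h
  · simp only [Prod.snd_sub, Prod.smul_snd, smul_eq_mul]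
    linear_combination -p.2 * h

theorem lin_coords (ξ : ℝ) (x y : ℤ) (v v' : ℤ × ℤ) :
    lin ξ (x • v - y • v') = x * lin ξ v - y * lin ξ v' := by
  simp only [lin, Prod.fst_sub, Prod.snd_sub, Prod.smul_fst, Prod.smul_snd, smul_eq_mul]
  push_cast
  ring

theorem lin_neg (ξ : ℝ) (p : ℤ × ℤ) : lin ξ (-p) = -lin ξ p := by
  simp only [lin, Prod.fst_neg, Prod.snd_neg]
  push_cast
  ring

theorem eq_or_eq_neg_of_smul_mem {x : ℤ} {v : ℤ × ℤ} (h : x • v ∈ primitivePairs) :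
    x • v = v ∨ x • v = -v := by
  simp only [primitivePairs, Set.mem_ofPred_eq, Prod.smul_fst, Prod.smul_snd, smul_eq_mul,
    Int.gcd_mul_left] at h
  have hx : x.natAbs = 1 := Nat.eq_one_of_mul_eq_one_right h
  rcases Int.natAbs_eq_iff.mp hx with rfl | rfl
  · left; simp
  · right; simp

/-- The digits `a` drive the reduced pair `(u, w)` through reduced pairs, every `a_j` being the
nearest integer. -/
structure IsReducedExpansion (a : ℕ → ℤ) (u w : ℝ) : Prop where
  reduced : ∀ n, Reduced (orbit a u n) (orbit a w n)
  near : ∀ n, |orbit a w n - a n| < 1 / 2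
  ne : ∀ n, orbit a w n ≠ a n

theorem orbit_digit (w : ℝ) (n : ℕ) : orbit (digit w) w n = completeQuotient w n := by
  induction n with
  | zero => rfl
  | succ n ih =>
    rw [orbit, ih, completeQuotient, digit, ← neg_sub, ← neg_div_neg_eq]
    simp

theorem irrational_completeQuotient {w : ℝ} (hw : Irrational w) (n : ℕ) :
    Irrational (completeQuotient w n) := by
  induction n with
  | zero => exact hw
  | succ n ih =>
    rw [completeQuotient, neg_div, one_div]
    exact (ih.sub_intCast _).inv.neg

theorem abs_sub_round_lt_of_irrational {x : ℝ} (hx : Irrational x) :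
    |x - (round x : ℝ)| < 1 / 2 := by
  refine lt_of_le_of_ne (abs_sub_round x) fun h => ?_
  rcases (abs_eq (by norm_num)).mp h with h | h
  · exact (hx.sub_intCast (round x)).ne_rational 1 2 (by rw [h]; norm_num)
  · exact (hx.sub_intCast (round x)).ne_rational (-1) 2 (by rw [h]; norm_num)

theorem isReducedExpansion_digit {u w : ℝ} (h : Reduced u w) (hw : Irrational w) :
    IsReducedExpansion (digit w) u w := by
  have near : ∀ n, |orbit (digit w) w n - digit w n| < 1 / 2 := fun n => by
    rw [orbit_digit]
    exact abs_sub_round_lt_of_irrational (irrational_completeQuotient hw n)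
  have ne : ∀ n, orbit (digit w) w n ≠ digit w n := fun n => by
    rw [orbit_digit]
    exact (irrational_completeQuotient hw n).ne_int _
  refine ⟨fun n => ?_, near, ne⟩
  induction n with
  | zero => exact h
  | succ n ih => exact ih.step (near n) (ne n)

/-! ### Growth of the convergents and the Legendre criterion along an expansion -/

namespace IsReducedExpansion

variable {a : ℕ → ℤ} {u w : ℝ}

theorem bounds (h : IsReducedExpansion a u w) (n : ℕ) :
    2 ≤ |(a n : ℝ)| ∧ |(a n : ℝ)| - lam ≤ |a n - orbit a u n| ∧
    |a n - orbit a u n| ≤ |(a n : ℝ)| + 1 - lam ∧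
    |(a n : ℝ)| - 1 / 2 - lam ≤ |orbit a w n - orbit a u n| ∧
    |orbit a w n - orbit a u n| ≤ |(a n : ℝ)| + 3 / 2 - lam ∧
    1.6 < |orbit a w n - orbit a u n| :=
  (h.reduced n).bounds (h.near n)

theorem one_lt_factor (h : IsReducedExpansion a u w) (n : ℕ) : 1.6 < |a n - orbit a u n| := by
  have := h.bounds n
  have := lam_bounds
  linarith

theorem lin_u (h : IsReducedExpansion a u w) (n : ℕ) :
    lin u (prevConv a n) = orbit a u n * lin u (conv a n) ∧
    lin u (conv a n) = ∏ j ∈ Finset.range n, (a j - orbit a u j) :=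
  lin_conv_aux a u (fun n => abs_pos.mp (by linarith [h.one_lt_factor n])) n

theorem lin_w (h : IsReducedExpansion a u w) (n : ℕ) :
    lin w (prevConv a n) = orbit a w n * lin w (conv a n) ∧
    lin w (conv a n) = ∏ j ∈ Finset.range n, (a j - orbit a w j) :=
  lin_conv_aux a w (fun n => sub_ne_zero.mpr (h.ne n).symm) n

/-- The size of the `n`-th convergent measured by the linear form of `u`. -/
theorem abs_lin_u_succ (h : IsReducedExpansion a u w) (n : ℕ) :
    |lin u (conv a (n + 1))| = |lin u (conv a n)| * |a n - orbit a u n| := by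
  rw [(h.lin_u _).2, (h.lin_u _).2, Finset.prod_range_succ, abs_mul]

theorem abs_lin_u_zero : |lin u (conv a 0)| = 1 := by
  simp [lin, conv, convPair]

theorem one_le_abs_lin_u (h : IsReducedExpansion a u w) (n : ℕ) :
    (1.6 : ℝ) ^ n ≤ |lin u (conv a n)| := by
  induction n with
  | zero => rw [abs_lin_u_zero]; norm_num
  | succ n ih =>
    rw [h.abs_lin_u_succ, pow_succ]
    exact mul_le_mul ih (h.one_lt_factor n).le (by norm_num) (abs_nonneg _)

theorem abs_lin_u_pos (h : IsReducedExpansion a u w) (n : ℕ) : 0 < |lin u (conv a n)| :=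
  lt_of_lt_of_le (by positivity) (h.one_le_abs_lin_u n)

theorem strictMono_abs_lin_u (h : IsReducedExpansion a u w) :
    StrictMono fun n => |lin u (conv a n)| := by
  refine strictMono_nat_of_lt_succ fun n => ?_
  rw [h.abs_lin_u_succ]
  nlinarith [h.one_lt_factor n, h.abs_lin_u_pos n]

theorem abs_lin_w_le_one (h : IsReducedExpansion a u w) (n : ℕ) : |lin w (conv a n)| ≤ 1 := by
  rw [(h.lin_w n).2, Finset.abs_prod]
  refine Finset.prod_le_one (fun _ _ => abs_nonneg _) fun j _ => ?_
  rw [abs_sub_comm]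
  linarith [h.near j]

/-- The value of the form `(x - w y) (x - u y)` at a convergent. -/
theorem lin_mul_lin_mul (h : IsReducedExpansion a u w) (n : ℕ) :
    lin w (conv a n) * lin u (conv a n) * (orbit a w n - orbit a u n) = w - u := by
  have hdet : ((conv a n).2 : ℝ) * (prevConv a n).1 - (conv a n).1 * (prevConv a n).2 = 1 := by
    exact_mod_cast conv_det a n
  have h1 := (h.lin_u n).1
  have h2 := (h.lin_w n).1
  simp only [lin] at h1 h2 ⊢
  linear_combination (w - u) * hdet - ((conv a n).1 - u * (conv a n).2) * h2 +
    ((conv a n).1 - w * (conv a n).2) * h1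

/-- Primitive vectors at which the form is small are convergents. -/
theorem eq_conv_of_small (h : IsReducedExpansion a u w) {p : ℤ × ℤ} (hp : p ∈ primitivePairs)
    (h1 : 1 ≤ |lin u p|) (h3 : 3 * (|lin w p| * |lin u p|) < |w - u|) :
    ∃ n, p = conv a n ∨ p = -conv a n := by
  have hex : ∃ n, |lin u p| < |lin u (conv a (n + 1))| := by
    obtain ⟨n, hn⟩ := pow_unbounded_of_one_lt |lin u p| (by norm_num : (1 : ℝ) < 1.6)
    exact ⟨n, hn.trans_le ((h.one_le_abs_lin_u n).trans (h.strictMono_abs_lin_u.monotone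
      n.le_succ))⟩
  classical
  obtain ⟨n, hn, hle⟩ : ∃ n, |lin u p| < |lin u (conv a (n + 1))| ∧
      |lin u (conv a n)| ≤ |lin u p| := by
    refine ⟨Nat.find hex, Nat.find_spec hex, ?_⟩
    -- The hypothesis `1 ≤ |lin u p|` is what places `p` above the convergent of index `0`.
    rcases hk : Nat.find hex with _ | k
    · rwa [abs_lin_u_zero]
    · exact not_lt.mp (Nat.find_min hex (by lia : k < Nat.find hex))
  refine ⟨n, ?_⟩
  obtain ⟨x, y, rfl⟩ := exists_coords a n p
  have hpos := h.abs_lin_u_pos n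
  have eu : lin u (x • conv a n - y • prevConv a n) =
      (x - orbit a u n * y) * lin u (conv a n) := by
    rw [lin_coords, (h.lin_u n).1]; ring
  have ew : lin w (x • conv a n - y • prevConv a n) =
      (x - orbit a w n * y) * lin w (conv a n) := by
    rw [lin_coords, (h.lin_w n).1]; ring
  rw [eu, abs_mul] at hle hn h3
  rw [ew, abs_mul, ← h.lin_mul_lin_mul n, abs_mul, abs_mul] at h3
  have hw0 : 0 < |lin w (conv a n)| := by
    rw [(h.lin_w n).2, abs_pos]
    exact Finset.prod_ne_zero_iff.mpr fun j _ => sub_ne_zero.mpr (h.ne j).symm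
  -- Dividing by the values at the `n`-th convergent reduces the claim to the pair `(u_n, w_n)`.
  have hy : y = 0 := by
    refine (h.reduced n).eq_zero_of_small (x := x) (h.near n) ?_ ?_ ?_
    · exact le_of_mul_le_mul_right (by linarith) hpos
    · rw [h.abs_lin_u_succ, mul_comm] at hn
      exact lt_of_mul_lt_mul_left hn hpos.le
    · refine lt_of_mul_lt_mul_left ?_ (mul_pos hw0 hpos).le
      linarith
  subst hy
  rw [zero_smul, sub_zero] at hp ⊢
  exact eq_or_eq_neg_of_smul_mem hp

/-- Upper bound for the growth of the convergents. -/
theorem abs_lin_u_le_prod (h : IsReducedExpansion a u w) {B : ℝ} (hB : 3 / 2 ≤ B) {m n : ℕ}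
    (hmn : m ≤ n) : |lin u (conv a m)| ≤ ∏ j ∈ Finset.range n, (|(a j : ℝ)| * B) := by
  refine (h.strictMono_abs_lin_u.monotone hmn).trans ?_
  rw [(h.lin_u n).2, Finset.abs_prod]
  refine Finset.prod_le_prod (fun _ _ => abs_nonneg _) fun j _ => ?_
  have := h.bounds j
  have := lam_bounds
  nlinarith

/-- Lower bound for the growth of the convergents. A digit `±2` may gain less than a factor `2`
only after a digit of absolute value at least `3`, which gains a spare factor `2`. -/
theorem prod_le_abs_lin_u (h : IsReducedExpansion a u w) {b : ℕ → ℝ}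
    (hb0 : ∀ j, 0 ≤ b j) (hb2 : ∀ j, |a j| = 2 → b j ≤ 2)
    (hb3 : ∀ j, |a j| ≠ 2 → b j ≤ |(a j : ℝ)| * (2 / 5)) (n : ℕ) :
    ∏ j ∈ Finset.range n, b j ≤ 2 * |lin u (conv a n)| := by
  suffices ∏ j ∈ Finset.range n, b j ≤ 2 * |lin u (conv a n)| ∧
      (orbit a w n * orbit a u n ≤ 0 ∨ ∏ j ∈ Finset.range n, b j ≤ |lin u (conv a n)|) from this.1
  induction n with
  | zero => rw [abs_lin_u_zero]; norm_num
  | succ n ih =>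
    obtain ⟨l1, l2⟩ := lam_bounds
    have hbd := h.bounds n
    have hP : 0 ≤ ∏ j ∈ Finset.range n, b j := Finset.prod_nonneg fun j _ => hb0 j
    have hf := h.one_lt_factor n
    have hpos := h.abs_lin_u_pos n
    rw [Finset.prod_range_succ, h.abs_lin_u_succ]
    by_cases h2 : |a n| = 2
    · refine ⟨?_, Or.inl ((h.reduced n).mul_nonpos_of_abs_eq_two (h.near n) h2)⟩
      have hbn := hb2 n h2
      have h2' : |(a n : ℝ)| = 2 := by exact_mod_cast h2
      rcases ih.2 with hs | hs
      · have := (h.reduced n).abs_le_of_mul_nonpos (h.near n) hs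
        calc _ ≤ (2 * |lin u (conv a n)|) * 2 := mul_le_mul ih.1 hbn (hb0 n) (by positivity)
          _ ≤ _ := by nlinarith
      · calc _ ≤ |lin u (conv a n)| * 2 := mul_le_mul hs hbn (hb0 n) (by positivity)
          _ ≤ _ := by nlinarith
    · have h3 : 3 ≤ |(a n : ℝ)| := by
        have : (2 : ℤ) ≤ |a n| := by exact_mod_cast hbd.1
        exact_mod_cast (by lia : (3 : ℤ) ≤ |a n|)
      have hbn := hb3 n h2
      -- For `|a_n| ≥ 3` one has `|a_n - u_n| ≥ |a_n| - λ ≥ (4/5) |a_n|`, which absorbs the factor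
      -- `2`.
      have key : (∏ j ∈ Finset.range n, b j) * b n ≤
          |lin u (conv a n)| * |a n - orbit a u n| := by
        calc _ ≤ (2 * |lin u (conv a n)|) * (|(a n : ℝ)| * (2 / 5)) :=
              mul_le_mul ih.1 hbn (hb0 n) (by positivity)
          _ ≤ _ := by nlinarith
      exact ⟨key.trans (by nlinarith), Or.inr key⟩

end IsReducedExpansion

/-! ### The constants -/

/-- The value `3/2` is enough, since `|a| + 1 - λ ≤ (3/2) |a|` for `|a| ≥ 2`. -/
theorem exp_c₀_ge : 3 / 2 ≤ Real.exp c₀ := by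
  have h5 : 2 ≤ √5 := Real.le_sqrt_of_sq_le (by norm_num)
  have h2 : 1 / 2 ≤ √(1 / 2 : ℝ) := Real.le_sqrt_of_sq_le (by norm_num)
  have e1 : Real.log (9 / 4) ≤ Real.log (3 * √5) := Real.log_le_log (by norm_num) (by linarith)
  have e2 : 0 ≤ Real.log (3 / 4 + √(1 / 2)) := Real.log_nonneg (by linarith)
  have e3 : Real.log (9 / 4) = 2 * Real.log (3 / 2) := by
    rw [show (9 / 4 : ℝ) = (3 / 2) ^ 2 by norm_num, Real.log_pow]; norm_num
  rw [← Real.log_le_iff_le_exp (by norm_num)]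
  unfold c₀
  linarith

/-- This says that `χ_j ≥ 0` for digits `±2`. -/
theorem dist_corner_vertex_le : dist cornerPoint vertexPoint ≤ 2 * Real.log 2 := by
  have h5 : (√5) ^ 2 = 5 := Real.sq_sqrt (by norm_num)
  have h5l : 2.236 < √5 := Real.lt_sqrt_of_sq_lt (by norm_num)
  have h5u : √5 < 2.237 := (Real.sqrt_lt' (by norm_num)).mpr (by norm_num)
  have hm : mu = (23 - 3 * √5) / 22 := rfl
  have hml : 0.74 < mu := by rw [hm]; linarith
  have hmu : mu < 0.741 := by rw [hm]; linarith
  have hyl : 0.67 < √(1 - mu ^ 2) := Real.lt_sqrt_of_sq_lt (by nlinarith)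
  have hyu : √(1 - mu ^ 2) < 0.675 := (Real.sqrt_lt' (by norm_num)).mpr (by nlinarith)
  have h3l : 1.73 < √3 := Real.lt_sqrt_of_sq_lt (by norm_num)
  have h3u : √3 < 1.74 := (Real.sqrt_lt' (by norm_num)).mpr (by norm_num)
  have hlog : 0 ≤ 2 * Real.log 2 := by positivity
  rw [← abs_of_nonneg hlog, ← abs_of_nonneg (dist_nonneg (x := cornerPoint) (y := vertexPoint)),
    ← Real.cosh_le_cosh, UpperHalfPlane.cosh_dist, Complex.dist_eq, Complex.sq_norm,
    Complex.normSq_apply]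
  have hc : Real.cosh (2 * Real.log 2) = 17 / 8 := by
    rw [show 2 * Real.log 2 = Real.log 4 by
      rw [show (4 : ℝ) = 2 ^ 2 by norm_num, Real.log_pow]; norm_num,
      Real.cosh_log (by norm_num)]
    norm_num
  rw [hc]
  have e1 : (cornerPoint : ℂ).re = mu := rfl
  have e2 : (cornerPoint : ℂ).im = √(1 - mu ^ 2) := rfl
  have e3 : (vertexPoint : ℂ).re = 3 / 2 := rfl
  have e4 : (vertexPoint : ℂ).im = √3 / 2 := rfl
  rw [Complex.sub_re, Complex.sub_im, ← UpperHalfPlane.coe_im, ← UpperHalfPlane.coe_im,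
    e1, e2, e3, e4]
  -- `cosh d` is `1` plus this quotient, and `9/8 = cosh (2 log 2) - 1`.
  have : ((mu - 3 / 2) * (mu - 3 / 2) + (√(1 - mu ^ 2) - √3 / 2) * (√(1 - mu ^ 2) - √3 / 2)) /
      (2 * √(1 - mu ^ 2) * (√3 / 2)) ≤ 9 / 8 := by
    rw [div_le_iff₀ (by positivity)]
    have : 0.67 * 1.73 ≤ √(1 - mu ^ 2) * √3 := by gcongr
    nlinarith
  linarith

theorem exp_neg_chi_eq_two {w : ℝ} {j : ℕ} (h : |digit w j| = 2) :
    absDigit w j * Real.exp (-chi w j) ≤ 2 := by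
  have h2 : absDigit w j = 2 := by unfold absDigit; exact_mod_cast h
  have hd := dist_corner_vertex_le
  have : Real.exp (-chi w j) ≤ 1 := by
    rw [Real.exp_le_one_iff, chi, if_pos h]
    linarith
  rw [h2]
  linarith

theorem exp_neg_chi_ne_two {w : ℝ} {j : ℕ} (h : |digit w j| ≠ 2) :
    absDigit w j * Real.exp (-chi w j) ≤ absDigit w j * (2 / 5) := by
  have h5 : 2.2 ≤ √5 := Real.le_sqrt_of_sq_le (by norm_num)
  refine mul_le_mul_of_nonneg_left ?_ (abs_nonneg _)
  have e1 : Real.log (25 / 4) ≤ Real.log (3 * √5) := Real.log_le_log (by norm_num) (by linarith)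
  have e2 : Real.log (25 / 4) = -(2 * Real.log (2 / 5)) := by
    rw [show (25 / 4 : ℝ) = ((2 / 5) ^ 2)⁻¹ by norm_num, Real.log_inv, Real.log_pow]; norm_num
  rw [← Real.le_log_iff_exp_le (by norm_num), chi, if_neg h]
  linarith

/-! ### Comparison of the linear forms with the Euclidean norm -/

theorem abs_lin_le_norm (ξ : ℝ) (p : ℤ × ℤ) : |lin ξ p| ≤ (1 + |ξ|) * euclNorm p := by
  have h0 := PiLp.norm_apply_le (!₂[(p.1 : ℝ), (p.2 : ℝ)]) 0
  have h1 := PiLp.norm_apply_le (!₂[(p.1 : ℝ), (p.2 : ℝ)]) 1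
  simp only [Matrix.cons_val_zero, Matrix.cons_val_one, Real.norm_eq_abs] at h0 h1
  calc |lin ξ p| ≤ |(p.1 : ℝ)| + |ξ * p.2| := abs_sub _ _
    _ = |(p.1 : ℝ)| + |ξ| * |(p.2 : ℝ)| := by rw [abs_mul]
    _ ≤ euclNorm p + |ξ| * euclNorm p :=
      add_le_add h0 (mul_le_mul_of_nonneg_left h1 (abs_nonneg _))
    _ = _ := by ring

theorem euclNorm_le_abs_add_abs (p : ℤ × ℤ) : euclNorm p ≤ |(p.1 : ℝ)| + |(p.2 : ℝ)| := by
  rw [euclNorm, EuclideanSpace.norm_eq, Real.sqrt_le_left (by positivity)]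
  simp only [Fin.sum_univ_two, Matrix.cons_val_zero, Matrix.cons_val_one, Real.norm_eq_abs]
  nlinarith [abs_nonneg (p.1 : ℝ), abs_nonneg (p.2 : ℝ)]

theorem exists_norm_le_lin {u w : ℝ} (h : u ≠ w) :
    ∃ C : ℝ, 0 < C ∧ ∀ p : ℤ × ℤ, euclNorm p ≤ C * (|lin u p| + |lin w p|) := by
  have hpos : 0 < |w - u| := abs_pos.mpr (sub_ne_zero.mpr h.symm)
  refine ⟨1 + (1 + |u|) / |w - u|, by positivity, fun p => ?_⟩
  have h2 : |(p.2 : ℝ)| ≤ (|lin u p| + |lin w p|) / |w - u| := by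
    rw [le_div_iff₀ hpos, ← abs_mul,
      show (p.2 : ℝ) * (w - u) = lin u p - lin w p by simp only [lin]; ring]
    exact abs_sub _ _
  have h1 : |(p.1 : ℝ)| ≤ |lin u p| + |u| * |(p.2 : ℝ)| := by
    rw [← abs_mul, show (p.1 : ℝ) = lin u p + u * p.2 by simp only [lin]; ring]
    exact abs_add_le _ _
  calc euclNorm p ≤ |(p.1 : ℝ)| + |(p.2 : ℝ)| := euclNorm_le_abs_add_abs p
    _ ≤ |lin u p| + (1 + |u|) * |(p.2 : ℝ)| := by linarith
    _ ≤ (|lin u p| + |lin w p|) + (1 + |u|) * ((|lin u p| + |lin w p|) / |w - u|) := by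
      gcongr
      linarith [abs_nonneg (lin w p)]
    _ = _ := by ring

/-! ### Translation of the hypotheses on `g` -/

/-- For `g` with rows `(a, b)`, `(c, d)` one has `u = b / d`, `w = a / c`, and `g⁻¹ v = (d (x - u
y), -c (x - w y))`. The determinant gives `c d (w - u) = 1`. -/
theorem exists_forms_eq_lin {g : SL(2, ℝ)} (hg : IsHReduced g) {w : ℝ}
    (hw : bdryAct g OnePoint.infty = (w : OnePoint ℝ)) :
    ∃ u d : ℝ, Reduced u w ∧ d ≠ 0 ∧ (∀ p, Lminus g (realVec p) = d * lin u p) ∧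
      ∀ p, |Q g (realVec p)| = |lin w p| * |lin u p| / |w - u| := by
  obtain ⟨u, w', hu, hw', hw2, hs⟩ := hg
  obtain rfl : w' = w := OnePoint.coe_injective (hw'.symm.trans hw)
  rw [bdryAct_infty] at hw
  rw [bdryAct_coe] at hu
  split_ifs at hw with hc
  · exact absurd hw (OnePoint.infty_ne_coe _)
  split_ifs at hu with hd
  · exact absurd hu (OnePoint.infty_ne_coe _)
  have hw := OnePoint.coe_injective hw
  have hu := OnePoint.coe_injective hu
  rw [mul_zero, zero_add] at hd
  rw [mul_zero, mul_zero, zero_add, zero_add, div_eq_iff hd] at hu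
  rw [div_eq_iff hc] at hw
  have hdet : g.val 0 0 * g.val 1 1 - g.val 0 1 * g.val 1 0 = 1 := by
    rw [← Matrix.det_fin_two]; exact g.2
  have hm : ∀ p, Lminus g (realVec p) = g.val 1 1 * lin u p := fun p => by
    simp only [Lminus, Matrix.SpecialLinearGroup.coe_inv, Matrix.adjugate_fin_two, realVec, lin,
      Matrix.mulVec, dotProduct, Fin.sum_univ_two]
    simp
    linear_combination -(p.2 : ℝ) * hu
  have hp : ∀ p, Lplus g (realVec p) = -g.val 1 0 * lin w' p := fun p => by
    simp only [Lplus, Matrix.SpecialLinearGroup.coe_inv, Matrix.adjugate_fin_two, realVec, lin,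
      Matrix.mulVec, dotProduct, Fin.sum_univ_two]
    simp
    linear_combination (p.2 : ℝ) * hw
  refine ⟨u, g.val 1 1, reduced_of_sign hw2 hs, hd, hm, fun p => ?_⟩
  have hcd : g.val 1 0 * g.val 1 1 * (w' - u) = 1 := by
    linear_combination hdet - g.val 1 1 * hw + g.val 1 0 * hu
  have hne : w' - u ≠ 0 := right_ne_zero_of_mul_eq_one hcd
  rw [eq_div_iff (abs_pos.mpr hne).ne', Q_eq_Lplus_mul_Lminus, hm, hp, ← abs_mul, ← abs_mul,
    ← abs_neg]
  congr 1
  linear_combination (lin w' p * lin u p) * hcd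

/-! ### Products of digits -/

theorem absDigit_pos_of {w : ℝ} (h : ∀ j, 2 ≤ absDigit w j) (j : ℕ) : 0 < absDigit w j := by
  linarith [h j]

theorem prod_absDigit_mul_exp {w : ℝ} (h : ∀ j, 2 ≤ absDigit w j) (f : ℕ → ℝ) (n : ℕ) :
    ∏ j ∈ Finset.range n, (absDigit w j * Real.exp (f j)) =
      Real.exp (alpha w n + ∑ j ∈ Finset.range n, f j) := by
  rw [alpha, ← Finset.sum_add_distrib, Real.exp_sum]
  refine Finset.prod_congr rfl fun j _ => ?_
  rw [Real.exp_add, Real.exp_log (absDigit_pos_of h j)]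

namespace IsReducedExpansion

variable {u w : ℝ}

theorem abs_lin_u_le_exp (h : IsReducedExpansion (digit w) u w) {m n : ℕ} (hmn : m ≤ n) :
    |lin u (conv (digit w) m)| ≤ Real.exp (alpha w n + c₀ * n) := by
  have := prod_absDigit_mul_exp (fun j => (h.bounds j).1) (fun _ => c₀) n
  rw [Finset.sum_const, Finset.card_range, nsmul_eq_mul, mul_comm (n : ℝ)] at this
  rw [← this]
  exact h.abs_lin_u_le_prod exp_c₀_ge hmn

theorem exp_le_abs_lin_u (h : IsReducedExpansion (digit w) u w) (n : ℕ) :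
    Real.exp (alpha w n - omega w n) ≤ 2 * |lin u (conv (digit w) n)| := by
  have := prod_absDigit_mul_exp (fun j => (h.bounds j).1) (fun j => -chi w j) n
  rw [Finset.sum_neg_distrib, ← sub_eq_add_neg] at this
  rw [omega, ← this]
  exact h.prod_le_abs_lin_u
    (fun j => mul_nonneg (abs_nonneg _) (Real.exp_pos _).le)
    (fun j hj => exp_neg_chi_eq_two hj) (fun j hj => exp_neg_chi_ne_two hj) n

end IsReducedExpansion

/-- The one of `p` and `-p` at which `d (x - u y)` is positive. -/
def orient (u d : ℝ) (p : ℤ × ℤ) : ℤ × ℤ :=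
  open Classical in if 0 < d * lin u p then p else -p

theorem orient_eq_or (u d : ℝ) (p : ℤ × ℤ) : orient u d p = p ∨ orient u d p = -p := by
  unfold orient; split_ifs <;> simp

theorem abs_lin_orient (u d ξ : ℝ) (p : ℤ × ℤ) : |lin ξ (orient u d p)| = |lin ξ p| := by
  rcases orient_eq_or u d p with h | h <;> rw [h]
  rw [lin_neg, abs_neg]

theorem mul_lin_orient (u d : ℝ) (p : ℤ × ℤ) : d * lin u (orient u d p) = |d| * |lin u p| := by
  rw [← abs_mul]
  unfold orient
  split_ifs with h
  · rw [abs_of_pos h]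
  · rw [lin_neg, mul_neg, abs_of_nonpos (not_lt.mp h)]

theorem eq_orient_of_pos {u d : ℝ} {p v : ℤ × ℤ} (h : p = v ∨ p = -v) (hp : 0 < d * lin u p) :
    p = orient u d v := by
  unfold orient
  rcases h with rfl | rfl
  · rw [if_pos hp]
  · rw [lin_neg, mul_neg] at hp
    rw [if_neg (by linarith)]

theorem orient_mem_primitivePairs {u d : ℝ} {p : ℤ × ℤ} (h : p ∈ primitivePairs) :
    orient u d p ∈ primitivePairs := by
  rcases orient_eq_or u d p with e | e <;> rw [e]
  · exact h
  · simpa [primitivePairs] using h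

/-! ### Counting -/

section Counting

variable {g : SL(2, ℝ)} {u w d δ κ : ℝ}

theorem abs_Q_orient_conv (h : IsReducedExpansion (digit w) u w)
    (hQ : ∀ p, |Q g (realVec p)| = |lin w p| * |lin u p| / |w - u|) (n : ℕ) :
    |Q g (realVec (orient u d (conv (digit w) n)))| =
      1 / |orbit (digit w) w n - orbit (digit w) u n| := by
  have h0 : 0 < |w - u| := by have := (h.bounds 0).2.2.2.2.2; simp only [orbit] at this; linarith
  have hn : 0 < |orbit (digit w) w n - orbit (digit w) u n| := by
    have := (h.bounds n).2.2.2.2.2; linarith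
  rw [hQ, abs_lin_orient, abs_lin_orient, div_eq_div_iff h0.ne' hn.ne', ← abs_mul, ← abs_mul,
    h.lin_mul_lin_mul, one_mul]

theorem exists_lower_bound (h : IsReducedExpansion (digit w) u w) (hd : d ≠ 0)
    (hm : ∀ p, Lminus g (realVec p) = d * lin u p)
    (hQ : ∀ p, |Q g (realVec p)| = |lin w p| * |lin u p| / |w - u|) (hδ : 0 < δ) :
    ∃ (θ : ℝ) (ν : ℕ), ∀ (n : ℕ) (ρ : ℝ), 0 < ρ → alpha w n + c₀ * n + θ ≤ Real.log ρ →
      eCount w δ n ≤ (solutions g δ κ ρ).ncard + ν := by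
  have huw : u ≠ w := by
    rintro rfl
    have := (h.bounds 0).2.2.2.2.2
    norm_num [orbit] at this
  obtain ⟨C, hC, hnorm⟩ := exists_norm_le_lin huw
  obtain ⟨J, hJ⟩ := pow_unbounded_of_one_lt (κ / |d|) (by norm_num : (1 : ℝ) < 1.6)
  have hdpos : 0 < |d| := abs_pos.mpr hd
  -- The factor `2` comes from `|lin w| ≤ 1 ≤ |lin u|` at convergents; from index `J` on, `L_g^- >
  -- κ` holds after orientation.
  refine ⟨Real.log (2 * C), J, fun n ρ hρ hle => ?_⟩
  have hρ' : 2 * C * Real.exp (alpha w n + c₀ * n) ≤ ρ := by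
    rw [Real.le_log_iff_exp_le hρ, Real.exp_add, Real.exp_log (by positivity)] at hle
    linarith
  set S := (Finset.range n).filter fun j => 2 / δ ^ 2 + 1 / 2 + lam < absDigit w j with hS
  have hcard : S.card ≤ (S \ Finset.range J).card + J := by
    have := Finset.le_card_sdiff (Finset.range J) S
    rw [Finset.card_range] at this
    lia
  refine hcard.trans (Nat.add_le_add_right ?_ J)
  rw [← Set.ncard_coe_finset]
  refine Set.ncard_le_ncard_of_injOn (fun j => orient u d (conv (digit w) j)) ?_ ?_
    (solutions_finite g δ κ ρ)
  · intro j hj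
    simp only [hS, Finset.coe_sdiff, Finset.coe_filter, Finset.coe_range, Set.mem_sdiff,
      Set.mem_ofPred_eq, Finset.mem_range, Set.mem_Iio, not_lt] at hj
    obtain ⟨⟨hjn, hbig⟩, hjJ⟩ := hj
    have hb := h.bounds j
    have hbig' : 2 / δ ^ 2 < |orbit (digit w) w j - orbit (digit w) u j| := by
      have : |(digit w j : ℝ)| = absDigit w j := rfl
      linarith [hb.2.2.2.1]
    have hpos : 0 < |orbit (digit w) w j - orbit (digit w) u j| := by linarith [hb.2.2.2.2.2]
    refine ⟨orient_mem_primitivePairs (conv_mem_primitivePairs _ _), ?_, ?_, ?_, ?_⟩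
    · rw [abs_Q_orient_conv h hQ]; positivity
    · rw [abs_Q_orient_conv h hQ, div_lt_iff₀ hpos]
      rw [div_lt_iff₀ (by positivity)] at hbig'
      linarith
    · rw [hm, mul_lin_orient, mul_comm, ← div_lt_iff₀ hdpos]
      exact hJ.trans_le ((pow_le_pow_right₀ (by norm_num) hjJ).trans (h.one_le_abs_lin_u j))
    · refine (hnorm _).trans (le_trans ?_ hρ')
      rw [abs_lin_orient, abs_lin_orient]
      have h1 : 1 ≤ |lin u (conv (digit w) j)| :=
        (one_le_pow₀ (by norm_num)).trans (h.one_le_abs_lin_u j)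
      have h2 := h.abs_lin_w_le_one j
      have h3 := h.abs_lin_u_le_exp hjn.le
      nlinarith
  · intro i _ j _ hij
    have := congrArg (fun p => |lin u p|) hij
    simp only [abs_lin_orient] at this
    exact h.strictMono_abs_lin_u.injective this

theorem exists_upper_bound (h : IsReducedExpansion (digit w) u w) (hd : d ≠ 0)
    (hm : ∀ p, Lminus g (realVec p) = d * lin u p)
    (hQ : ∀ p, |Q g (realVec p)| = |lin w p| * |lin u p| / |w - u|) (hδ : 0 < δ)
    (hδ' : 3 * δ ^ 2 ≤ 2) (hκ : 0 < κ) :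
    ∃ (θ : ℝ) (ν : ℕ), ∀ (n : ℕ) (ρ : ℝ), 0 < ρ → Real.log ρ ≤ alpha w n - omega w n - θ →
      (solutions g δ κ ρ).ncard ≤ fCount w δ n + ν := by
  have huw : u ≠ w := by
    rintro rfl
    have := (h.bounds 0).2.2.2.2.2
    norm_num [orbit] at this
  obtain ⟨C, hC, hnorm⟩ := exists_norm_le_lin huw
  have hdpos : 0 < |d| := abs_pos.mpr hd
  have hD : 0 < |w - u| := abs_pos.mpr (sub_ne_zero.mpr huw.symm)
  -- `R` bounds the norm of solutions with `|lin u p| < 1`: there `|lin u p| > κ / |d|`, so the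
  -- bound on `Q` bounds `|lin w p|`.
  set R := C * (1 + δ ^ 2 * |w - u| * |d| / κ) with hR
  refine ⟨Real.log (2 * (1 + |u|)) + 1, (solutions g δ κ R).ncard, fun n ρ hρ hle => ?_⟩
  have hρ' : 2 * (1 + |u|) * ρ < Real.exp (alpha w n - omega w n) := by
    rw [← Real.log_lt_iff_lt_exp (by positivity), Real.log_mul (by positivity) hρ.ne']
    linarith
  set S := (Finset.range n).filter fun j => 2 / δ ^ 2 - 3 / 2 + lam < absDigit w j with hS
  have hsub : solutions g δ κ ρ ⊆
      (fun j => orient u d (conv (digit w) j)) '' (S : Set ℕ) ∪ solutions g δ κ R := by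
    rintro p ⟨hp, hQ0, hQ1, hL, hn⟩
    have hQ2 := hQ1
    rw [hm] at hL
    rw [hQ, div_lt_iff₀ hD] at hQ2
    by_cases h1 : 1 ≤ |lin u p|
    · left
      obtain ⟨j, hj⟩ := h.eq_conv_of_small hp h1 (by nlinarith)
      have hpj := eq_orient_of_pos hj (hκ.trans hL)
      refine ⟨j, ?_, hpj.symm⟩
      simp only [hS, Finset.coe_filter, Finset.mem_range, Set.mem_ofPred_eq]
      have hb := h.bounds j
      constructor
      -- If `j ≥ n`, monotonicity gives `exp (α_n - ω_n) ≤ 2 |lin u p| ≤ 2 (1 + |u|) ρ`; the `+ 1`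
      -- in `θ` makes this a strict contradiction.
      · by_contra! hnj
        have e1 := h.exp_le_abs_lin_u n
        have e2 := h.strictMono_abs_lin_u.monotone hnj
        have e3 := abs_lin_le_norm u p
        rw [hpj, abs_lin_orient, ← hpj] at e3
        have e4 : (1 + |u|) * euclNorm p ≤ (1 + |u|) * ρ :=
          mul_le_mul_of_nonneg_left hn (by positivity)
        linarith
      · have hpos : 0 < |orbit (digit w) w j - orbit (digit w) u j| := by
          linarith [hb.2.2.2.2.2]
        rw [hpj, abs_Q_orient_conv h hQ, div_lt_iff₀ hpos] at hQ1
        have : 2 / δ ^ 2 < |orbit (digit w) w j - orbit (digit w) u j| := by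
          rw [div_lt_iff₀ (by positivity)]; linarith
        have e : |(digit w j : ℝ)| = absDigit w j := rfl
        linarith [hb.2.2.2.2.1]
    · right
      refine ⟨hp, hQ0, hQ1, by rwa [hm], (hnorm p).trans ?_⟩
      refine mul_le_mul_of_nonneg_left (add_le_add (not_le.mp h1).le ?_) hC.le
      rw [le_div_iff₀ hκ]
      have hk : κ ≤ |d| * |lin u p| := by
        rw [← abs_mul]; exact hL.le.trans (le_abs_self _)
      calc |lin w p| * κ ≤ |lin w p| * (|d| * |lin u p|) :=
            mul_le_mul_of_nonneg_left hk (abs_nonneg _)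
        _ = (|lin w p| * |lin u p|) * |d| := by ring
        _ ≤ (δ ^ 2 * |w - u|) * |d| := by
          refine mul_le_mul_of_nonneg_right ?_ hdpos.le
          have : 0 < δ ^ 2 * |w - u| := by positivity
          linarith
  calc (solutions g δ κ ρ).ncard
      ≤ ((fun j => orient u d (conv (digit w) j)) '' (S : Set ℕ) ∪ solutions g δ κ R).ncard :=
        Set.ncard_le_ncard hsub ((S.finite_toSet.image _).union (solutions_finite g δ κ R))
    _ ≤ ((fun j => orient u d (conv (digit w) j)) '' (S : Set ℕ)).ncard +
        (solutions g δ κ R).ncard := Set.ncard_union_le _ _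
    _ ≤ S.card + (solutions g δ κ R).ncard := by
        refine Nat.add_le_add_right ?_ _
        rw [← Set.ncard_coe_finset S]
        exact Set.ncard_image_le S.finite_toSet

end Counting

end HReducedForms

end

theorem theorem4p1 (g : Matrix.SpecialLinearGroup (Fin 2) ℝ) (hg : HReducedForms.IsHReduced g)
    (w : ℝ) (hw : HReducedForms.bdryAct g OnePoint.infty = (w : OnePoint ℝ))
    (hirr : Irrational w)
    (δ κ : ℝ) (hδ0 : 0 < δ) (hδ : δ < √(2 / Real.pi)) (hκ : 0 < κ) :
    ∃ (θ : ℝ) (ν : ℕ), 0 ≤ θ ∧ ∀ (n : ℕ) (ρ : ℝ), 0 < ρ →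
      (HReducedForms.alpha w n + HReducedForms.c₀ * n + θ ≤ Real.log ρ →
        (HReducedForms.eCount w δ n : ℝ) - ν ≤ (HReducedForms.solutions g δ κ ρ).ncard) ∧
      (Real.log ρ ≤ HReducedForms.alpha w n - HReducedForms.omega w n - θ →
        ((HReducedForms.solutions g δ κ ρ).ncard : ℝ) ≤ HReducedForms.fCount w δ n + ν) := by
  obtain ⟨u, d, hred, hd, hm, hQ⟩ := HReducedForms.exists_forms_eq_lin hg hw
  have h := HReducedForms.isReducedExpansion_digit hred hirr
  -- `π > 3` brings `δ² / 2` below the constant `1/3` of the Legendre criterion.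
  have hδ2 : 3 * δ ^ 2 ≤ 2 := by
    have h1 := (Real.lt_sqrt hδ0.le).mp hδ
    rw [lt_div_iff₀ Real.pi_pos] at h1
    nlinarith [Real.pi_gt_three, sq_nonneg δ]
  obtain ⟨θ₁, ν₁, h₁⟩ := HReducedForms.exists_lower_bound (κ := κ) h hd hm hQ hδ0
  obtain ⟨θ₂, ν₂, h₂⟩ := HReducedForms.exists_upper_bound h hd hm hQ hδ0 hδ2 hκ
  refine ⟨max 0 (max θ₁ θ₂), ν₁ + ν₂, le_max_left _ _, fun n ρ hρ => ⟨fun hle => ?_, fun hle => ?_⟩⟩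
  · have hθ : θ₁ ≤ max 0 (max θ₁ θ₂) := (le_max_left _ _).trans (le_max_right _ _)
    have key : (HReducedForms.eCount w δ n : ℝ) ≤
        (HReducedForms.solutions g δ κ ρ).ncard + ν₁ := by
      exact_mod_cast h₁ n ρ hρ (by linarith)
    push_cast
    linarith [Nat.cast_nonneg (α := ℝ) ν₂]
  · have hθ : θ₂ ≤ max 0 (max θ₁ θ₂) := (le_max_right _ _).trans (le_max_right _ _)
    have key : ((HReducedForms.solutions g δ κ ρ).ncard : ℝ) ≤
        HReducedForms.fCount w δ n + ν₂ := by
      exact_mod_cast h₂ n ρ hρ (by linarith)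
    push_cast
    linarith [Nat.cast_nonneg (α := ℝ) ν₁]
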